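/- Let $X$ be a $T_1$-space. A set-valued mapping $\varphi$ from $X$ to the nonempty subsets of a metric space $(E,d)$ is called l.s.c. if $\{x\in X:\varphi(x)\cap U\neq\emptyset\}$ is open in $X$ for every open $U\subset E$. A map $f:X\to E$ is a selection for $\varphi$ if $f(x)\in\varphi(x)$ for all $x\in X$. For a function $\eta:X\to(0,+\infty)$, a map $g:X\to E$ is an $\eta$-selection for $\varphi$ if $d(g(x),\varphi(x))=\inf_{y\in\varphi(x)}d(g(x),y)<\eta(x)$ for all $x\in X$. The function $\eta$ is lower semi-continuous if $\{x\in X:\eta(x)>r\}$ is open for every $r\in\mathbb{R}$. The space $X$ is countably paracompact if every countable open cover of $X$ has a locally finite open refinement. Banach spaces are real and carry the metric $d$ of their norm. Then the following are equivalent: (a) $X$ is countably paracompact and normal. (b) For every separable Banach space $E$, every l.s.c. mapping $\varphi$ from $X$ to the nonempty closed convex subsets of $E$, every lower semi-continuous $\eta:X\to(0,+\infty)$ and every continuous $\eta$-selection $g:X\to E$ for $\varphi$, there is a continuous selection $f:X\to E$ for $\varphi$ such that $d(f(x),g(x))<\eta(x)$ for all $x\in X$. (c) For every l.s.c. mapping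 $\varphi$ from $X$ to the nonempty compact convex subsets of $\mathbb{R}$, every real number $\varepsilon>0$ and every continuous $\varepsilon$-selection $g:X\to\mathbb{R}$ for $\varphi$ (that is, an $\eta$-selection for the constant function $\eta=\varepsilon$), there is a continuous selection $f:X\to\mathbb{R}$ for $\varphi$ such that $|f(x)-g(x)|<\varepsilon$ for all $x\in X$. -/

import Mathlib

universe u v

/-- A topological space is countably paracompact if every countable open cover has a
locally finite open refinement. -/
class CountablyParacompactSpace (X : Type u) [TopologicalSpace X] : Prop where
  locallyFinite_refinement :
    ∀ s : ℕ → Set X, (∀ n, IsOpen (s n)) → (⋃ n, s n) = Set.univ →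
      ∃ (β : Type u) (t : β → Set X),
        (∀ b, IsOpen (t b)) ∧ (⋃ b, t b) = Set.univ ∧ LocallyFinite t ∧ ∀ b, ∃ n, t b ⊆ s n

/-- `f` is a selection for the set-valued mapping `φ`. -/
def IsSelection {X E : Type*} (φ : X → Set E) (f : X → E) : Prop :=
  ∀ x, f x ∈ φ x

/-- `g` is an `η`-selection for the set-valued mapping `φ` (with nonempty values):
the distance from `g x` to the set `φ x` is less than `η x`, for every `x`. -/
def IsApproxSelection {X E : Type*} [PseudoMetricSpace E]
    (φ : X → Set E) (η : X → ℝ) (g : X → E) : Prop :=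
  ∀ x, Metric.infDist (g x) (φ x) < η x

/-
For (a) ⇒ (b), partitions of unity subordinate to countable open covers glue points of a countable
dense subset of `E`. This yields approximate selections of every accuracy, hence, by successive
refinement, selections of the closure of `φ`. The mapping `x ↦ infDist (g x) (φ x)` is upper
semicontinuous, so a continuous `α` fits strictly between it and `η`, and a selection of the closure
of `φ x ∩ ball (g x) (α x)` is as required.

For (c) ⇒ (a), `x ↦ Icc (a x) (b x)` is lower hemicontinuous whenever `a ≤ b` are upper and lower
semicontinuous. Indicator functions for `a` and `b` give Urysohn functions, hence normality. With
`a = 0`, `b > 0` and `g = ε = 1` the selection is forced to be positive, and positive continuous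
minorants of positive lower semicontinuous functions refine countable covers.
-/

open Set Filter Topology Metric TopologicalSpace

lemma isApproxSelection_iff_inter_ball_nonempty {X E : Type*} [PseudoMetricSpace E]
    {φ : X → Set E} {η : X → ℝ} {g : X → E} (hne : ∀ x, (φ x).Nonempty) :
    IsApproxSelection φ η g ↔ ∀ x, (φ x ∩ ball (g x) (η x)).Nonempty :=
  forall_congr' fun x => by
    simp only [infDist_lt_iff (hne x), Set.Nonempty, mem_inter_iff, mem_ball']

section LowerHemicontinuous

variable {X E F : Type*} [TopologicalSpace X]

lemma lowerHemicontinuous_image [TopologicalSpace E] [TopologicalSpace F] {φ : X → Set E}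
    (hφ : LowerHemicontinuous φ) {L : E → F} (hL : Continuous L) :
    LowerHemicontinuous fun x => L '' φ x := by
  refine lowerHemicontinuous_iff_isOpen_inter_nonempty.2 fun u hu => ?_
  simpa only [image_inter_nonempty_iff] using
    lowerHemicontinuous_iff_isOpen_inter_nonempty.1 hφ _ (hu.preimage hL)

lemma lowerHemicontinuous_Icc [LinearOrder E] [TopologicalSpace E] [OrderTopology E] {a b : X → E}
    (ha : UpperSemicontinuous a) (hb : LowerSemicontinuous b) (hab : ∀ x, a x ≤ b x) :
    LowerHemicontinuous fun x => Icc (a x) (b x) := by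
  refine fun x => lowerHemicontinuousAt_iff.2 fun u hu ⟨y, ⟨hay, hyb⟩, hyu⟩ => ?_
  have hclamp : Tendsto (fun x' => max (a x') (min (b x') y)) (𝓝 x) (𝓝 y) := by
    refine tendsto_order.2 ⟨fun c hc => ?_, fun c hc => ?_⟩
    · filter_upwards [hb x c (hc.trans_le hyb)] with x' hx'
      exact lt_max_of_lt_right (lt_min hx' hc)
    · filter_upwards [ha x c (hay.trans_lt hc)] with x' hx'
      exact max_lt hx' (min_lt_of_right_lt hc)
  filter_upwards [hclamp.eventually_mem (hu.mem_nhds hyu)] with x' hx'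
  exact ⟨_, ⟨le_max_left _ _, max_le (hab x') (min_le_left _ _)⟩, hx'⟩

variable [PseudoMetricSpace E] {φ : X → Set E} {g : X → E}

lemma lowerHemicontinuous_inter_ball (hφ : LowerHemicontinuous φ) (hg : Continuous g) {r : X → ℝ}
    (hr : LowerSemicontinuous r) : LowerHemicontinuous fun x => φ x ∩ ball (g x) (r x) := by
  refine hφ.inter_hasOpenCGraph ?_
  have hdist : Continuous fun p : X × E => -dist p.2 (g p.1) :=
    (continuous_snd.dist (hg.comp continuous_fst)).neg
  have hlsc : LowerSemicontinuous fun p : X × E => r p.1 + -dist p.2 (g p.1) :=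
    (hr.comp continuous_fst).add hdist.lowerSemicontinuous
  simpa [HasOpenCGraph, preimage, ← sub_eq_add_neg] using hlsc.isOpen_preimage 0

lemma isOpen_setOf_inter_ball_nonempty (hφ : LowerHemicontinuous φ) (hg : Continuous g) {r : X → ℝ}
    (hr : LowerSemicontinuous r) : IsOpen {x | (φ x ∩ ball (g x) (r x)).Nonempty} := by
  simpa only [inter_univ] using lowerHemicontinuous_iff_isOpen_inter_nonempty.1
    (lowerHemicontinuous_inter_ball hφ hg hr) univ isOpen_univ

lemma upperSemicontinuous_infDist (hφ : LowerHemicontinuous φ) (hne : ∀ x, (φ x).Nonempty)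
    (hg : Continuous g) : UpperSemicontinuous fun x => infDist (g x) (φ x) := by
  refine upperSemicontinuous_iff_isOpen_preimage.2 fun r => ?_
  convert isOpen_setOf_inter_ball_nonempty hφ hg (lowerSemicontinuous_const (z := r)) using 1
  ext x
  simp only [mem_preimage, mem_Iio, infDist_lt_iff (hne x), mem_ofPred_eq, Set.Nonempty,
    mem_inter_iff, mem_ball']

end LowerHemicontinuous

lemma exists_continuous_tendstoUniformly_of_dist_le_summable {X E : Type*} [TopologicalSpace X]
    [PseudoMetricSpace E] [CompleteSpace E] {F : ℕ → X → E} (hF : ∀ n, Continuous (F n))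
    {d : ℕ → ℝ} (hd : Summable d) (hFd : ∀ n x, dist (F n x) (F (n + 1) x) ≤ d n) :
    ∃ f : X → E, Continuous f ∧ TendstoUniformly F f atTop := by
  choose f hf using fun x =>
    cauchySeq_tendsto_of_complete (cauchySeq_of_dist_le_of_summable d (fun n => hFd n x) hd)
  have htail : Tendsto (fun n => ∑' m, d (n + m)) atTop (𝓝 0) := by
    simpa only [add_comm] using tendsto_sum_nat_add d
  have hunif : TendstoUniformly F f atTop := by
    refine Metric.tendstoUniformly_iff.2 fun ε hε => ?_
    filter_upwards [htail.eventually_lt_const hε] with n hn x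
    rw [dist_comm]
    exact (dist_le_tsum_of_dist_le_of_tendsto d (fun n => hFd n x) hd (hf x) n).trans_lt hn
  exact ⟨f, hunif.continuous (Frequently.of_forall hF), hunif⟩

section Sufficiency

variable {X : Type u} [TopologicalSpace X] [NormalSpace X] [CountablyParacompactSpace X]

theorem exists_continuous_forall_mem_convex_of_countable_cover {E : Type*} [AddCommGroup E]
    [Module ℝ E] [TopologicalSpace E] [ContinuousAdd E] [ContinuousSMul ℝ E] {U : ℕ → Set X}
    {c : ℕ → X → E} {t : X → Set E} (hU : ∀ n, IsOpen (U n)) (hcov : ∀ x, ∃ n, x ∈ U n)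
    (hc : ∀ n, ContinuousOn (c n) (U n)) (ht : ∀ x, Convex ℝ (t x))
    (hct : ∀ n, ∀ x ∈ U n, c n x ∈ t x) :
    ∃ f : X → E, Continuous f ∧ ∀ x, f x ∈ t x := by
  obtain ⟨β, V, hV, hVcov, hVlf, hVU⟩ :=
    CountablyParacompactSpace.locallyFinite_refinement U hU (iUnion_eq_univ_iff.2 hcov)
  choose n hn using hVU
  obtain ⟨ρ, hρ⟩ :=
    PartitionOfUnity.exists_isSubordinate_of_locallyFinite isClosed_univ V hV hVlf hVcov.ge
  refine ⟨fun x => ∑ᶠ b, ρ b x • c (n b) x,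
    hρ.continuous_finsum_smul hV fun b => (hc _).mono (hn b), fun x => ?_⟩
  exact ρ.finsum_smul_mem_convex (mem_univ x)
    (fun b hb => hct _ _ (hn b (hρ b (subset_closure hb)))) (ht x)

theorem exists_continuous_mem_Ioo_of_semicontinuous {h η : X → ℝ} (hh : UpperSemicontinuous h)
    (hη : LowerSemicontinuous η) (hlt : ∀ x, h x < η x) :
    ∃ α : X → ℝ, Continuous α ∧ ∀ x, α x ∈ Ioo (h x) (η x) := by
  obtain ⟨q, hq⟩ := exists_dense_seq ℝ
  exact exists_continuous_forall_mem_convex_of_countable_cover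
    (U := fun n => {x | h x < q n} ∩ {x | q n < η x}) (c := fun n _ => q n)
    (fun n => (hh.isOpen_preimage (q n)).inter (hη.isOpen_preimage (q n)))
    (fun x => hq.exists_mem_open isOpen_Ioo (nonempty_Ioo.2 (hlt x)))
    (fun n => continuousOn_const) (fun x => convex_Ioo _ _) fun n x hx => hx

section Seminormed

variable {E : Type*} [SeminormedAddCommGroup E] [NormedSpace ℝ E] [SeparableSpace E]
  {φ : X → Set E}

theorem exists_continuous_isApproxSelection (hφ : LowerHemicontinuous φ)
    (hne : ∀ x, (φ x).Nonempty) (hconv : ∀ x, Convex ℝ (φ x)) {η : X → ℝ}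
    (hη : LowerSemicontinuous η) (hη0 : ∀ x, 0 < η x) :
    ∃ f : X → E, Continuous f ∧ IsApproxSelection φ η f := by
  obtain ⟨q, hq⟩ := exists_dense_seq E
  obtain ⟨f, hf, hfφ⟩ := exists_continuous_forall_mem_convex_of_countable_cover
    (U := fun n => {x | (φ x ∩ ball (q n) (η x)).Nonempty}) (c := fun n _ => q n)
    (t := fun x => thickening (η x) (φ x))
    (fun n => isOpen_setOf_inter_ball_nonempty hφ continuous_const hη)
    (fun x => by
      obtain ⟨y, hy⟩ := hne x
      obtain ⟨n, hn⟩ := hq.exists_dist_lt y (hη0 x)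
      exact ⟨n, y, hy, hn⟩)
    (fun n => continuousOn_const) (fun x => (hconv x).thickening _)
    (fun n x ⟨y, hy, hyn⟩ => mem_thickening_iff.2 ⟨y, hy, mem_ball'.1 hyn⟩)
  exact ⟨f, hf, fun x => (infDist_lt_iff (hne x)).2 (mem_thickening_iff.1 (hfφ x))⟩

theorem exists_continuous_isApproxSelection_dist_lt (hφ : LowerHemicontinuous φ)
    (hne : ∀ x, (φ x).Nonempty) (hconv : ∀ x, Convex ℝ (φ x)) {r s : X → ℝ}
    (hr : LowerSemicontinuous r) (hs : LowerSemicontinuous s) (hs0 : ∀ x, 0 < s x) {f : X → E}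
    (hf : Continuous f) (hfφ : IsApproxSelection φ r f) :
    ∃ f' : X → E, Continuous f' ∧ IsApproxSelection φ s f' ∧
      ∀ x, dist (f x) (f' x) < r x + s x := by
  have hψne := (isApproxSelection_iff_inter_ball_nonempty hne).1 hfφ
  obtain ⟨f', hf', hf'ψ⟩ := exists_continuous_isApproxSelection
    (lowerHemicontinuous_inter_ball hφ hf hr) hψne (fun x => (hconv x).inter (convex_ball _ _))
    hs hs0
  refine ⟨f', hf', fun x => ?_, fun x => ?_⟩
  · exact (infDist_le_infDist_of_subset inter_subset_left (hψne x)).trans_lt (hf'ψ x)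
  · obtain ⟨y, ⟨-, hyf⟩, hyf'⟩ := (infDist_lt_iff (hψne x)).1 (hf'ψ x)
    calc dist (f x) (f' x) ≤ dist y (f x) + dist (f' x) y := by
          rw [dist_comm (f' x)]; exact dist_triangle_left _ _ _
      _ < r x + s x := add_lt_add hyf hyf'

theorem exists_continuous_isSelection_closure [CompleteSpace E] (hφ : LowerHemicontinuous φ)
    (hne : ∀ x, (φ x).Nonempty) (hconv : ∀ x, Convex ℝ (φ x)) :
    ∃ f : X → E, Continuous f ∧ IsSelection (fun x => closure (φ x)) f := by
  let r : ℕ → ℝ := fun n => (1 / 2) ^ n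
  have hr0 : ∀ n, 0 < r n := fun n => by positivity
  have hr : Summable r := summable_geometric_two
  have hstep : ∀ n (f : X → E), Continuous f ∧ IsApproxSelection φ (fun _ => r n) f →
      ∃ f' : X → E, (Continuous f' ∧ IsApproxSelection φ (fun _ => r (n + 1)) f') ∧
        ∀ x, dist (f x) (f' x) < r n + r (n + 1) := fun n f ⟨hf, hfφ⟩ => by
    simpa only [and_assoc] using exists_continuous_isApproxSelection_dist_lt hφ hne hconv
      lowerSemicontinuous_const lowerSemicontinuous_const (fun _ => hr0 (n + 1)) hf hfφ
  choose! next hnext hdist using hstep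
  obtain ⟨f₀, hf₀⟩ := exists_continuous_isApproxSelection hφ hne hconv
    (lowerSemicontinuous_const (z := r 0)) fun _ => hr0 0
  let F : ℕ → X → E := fun n => Nat.rec f₀ next n
  have hF : ∀ n, Continuous (F n) ∧ IsApproxSelection φ (fun _ => r n) (F n) := fun n => by
    induction n with
    | zero => exact hf₀
    | succ n ih => exact hnext n _ ih
  obtain ⟨f, hf, hFf⟩ := exists_continuous_tendstoUniformly_of_dist_le_summable
    (fun n => (hF n).1) (hr.add ((summable_nat_add_iff 1).2 hr)) fun n x =>
      (hdist n _ (hF n) x).le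
  refine ⟨f, hf, fun x => (mem_closure_iff_infDist_zero (hne x)).2 ?_⟩
  have hFx : Tendsto (fun n => infDist (F n x) (φ x)) atTop (𝓝 (infDist (f x) (φ x))) :=
    ((continuous_infDist_pt _).tendsto _).comp (hFf.tendsto_at x)
  exact tendsto_nhds_unique hFx
    (squeeze_zero (fun _ => infDist_nonneg) (fun n => ((hF n).2 x).le) hr.tendsto_atTop_zero)

end Seminormed

end Sufficiency

/-- Condition (b) of the theorem for a fixed Banach space `E`: approximate selections of lower
hemicontinuous mappings into the nonempty closed convex subsets of `E` can be replaced by selections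
that obey the same strict bound. -/
def HasNearbySelections (X : Type*) [TopologicalSpace X] (E : Type*) [NormedAddCommGroup E]
    [NormedSpace ℝ E] : Prop :=
  ∀ (φ : X → Set E) (η : X → ℝ) (g : X → E),
    (∀ x, (φ x).Nonempty) → (∀ x, IsClosed (φ x)) → (∀ x, Convex ℝ (φ x)) →
    LowerHemicontinuous φ →
    (∀ x, 0 < η x) → LowerSemicontinuous η →
    Continuous g → IsApproxSelection φ η g →
    ∃ f : X → E, Continuous f ∧ IsSelection φ f ∧ ∀ x, dist (f x) (g x) < η x

/-- Condition (c) of the theorem: the analogue of `HasNearbySelections` for mappings into the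
nonempty compact intervals of the real line and constant bounds. -/
def HasNearbyIntervalSelections (X : Type*) [TopologicalSpace X] : Prop :=
  ∀ (φ : X → Set ℝ) (ε : ℝ) (g : X → ℝ),
    (∀ x, (φ x).Nonempty) → (∀ x, IsCompact (φ x)) → (∀ x, Convex ℝ (φ x)) →
    LowerHemicontinuous φ →
    0 < ε →
    Continuous g → IsApproxSelection φ (fun _ => ε) g →
    ∃ f : X → ℝ, Continuous f ∧ IsSelection φ f ∧ ∀ x, dist (f x) (g x) < ε

theorem hasNearbySelections_of_countablyParacompactSpace (X : Type u) [TopologicalSpace X]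
    [NormalSpace X] [CountablyParacompactSpace X] (E : Type*) [NormedAddCommGroup E]
    [NormedSpace ℝ E] [CompleteSpace E] [SeparableSpace E] : HasNearbySelections X E := by
  rintro φ η g hne hcl hconv hφ - hη hg hgφ
  obtain ⟨α, hα, hαη⟩ := exists_continuous_mem_Ioo_of_semicontinuous
    (upperSemicontinuous_infDist hφ hne hg) hη hgφ
  obtain ⟨f, hf, hfφ⟩ := exists_continuous_isSelection_closure
    (lowerHemicontinuous_inter_ball hφ hg hα.lowerSemicontinuous)
    ((isApproxSelection_iff_inter_ball_nonempty hne).1 fun x => (hαη x).1)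
    (fun x => (hconv x).inter (convex_ball _ _))
  refine ⟨f, hf, fun x => ?_, fun x => ?_⟩
  · exact closure_minimal inter_subset_left (hcl x) (hfφ x)
  · have hball : f x ∈ closedBall (g x) (α x) :=
      closure_minimal (inter_subset_right.trans ball_subset_closedBall) isClosed_closedBall (hfφ x)
    exact (mem_closedBall.1 hball).trans_lt (hαη x).2

namespace HasNearbySelections

variable {X : Type*} [TopologicalSpace X]

lemma of_linearIsometryEquiv {E F : Type*} [NormedAddCommGroup E] [NormedSpace ℝ E]
    [NormedAddCommGroup F] [NormedSpace ℝ F] (h : HasNearbySelections X F) (L : E ≃ₗᵢ[ℝ] F) :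
    HasNearbySelections X E := by
  intro φ η g hne hcl hconv hφ hη0 hη hg hgφ
  obtain ⟨f, hf, hfφ, hfg⟩ := h (fun x => L '' φ x) η (fun x => L (g x))
    (fun x => (hne x).image L) (fun x => L.toHomeomorph.isClosed_image.2 (hcl x))
    (fun x => (hconv x).linear_image L.toLinearEquiv.toLinearMap)
    (lowerHemicontinuous_image hφ L.continuous) hη0 hη (L.continuous.comp hg)
    (fun x => by simpa only [infDist_image L.isometry] using hgφ x)
  refine ⟨fun x => L.symm (f x), L.symm.continuous.comp hf, fun x => ?_, fun x => ?_⟩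
  · obtain ⟨y, hy, hyf⟩ := hfφ x
    simpa only [← hyf, L.symm_apply_apply] using hy
  · rw [← L.dist_map, L.apply_symm_apply]
    exact hfg x

lemma hasNearbyIntervalSelections (h : HasNearbySelections X ℝ) :
    HasNearbyIntervalSelections X :=
  fun φ ε g hne hcpt hconv hφ hε hg hgφ => h φ (fun _ => ε) g hne (fun x => (hcpt x).isClosed) hconv
    hφ (fun _ => hε) lowerSemicontinuous_const hg hgφ

end HasNearbySelections

theorem countablyParacompactSpace_of_exists_continuous_pos_le {X : Type u} [TopologicalSpace X]
    (h : ∀ k : X → ℝ, LowerSemicontinuous k → (∀ x, 0 < k x) →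
      ∃ f : X → ℝ, Continuous f ∧ ∀ x, 0 < f x ∧ f x ≤ k x) :
    CountablyParacompactSpace X := by
  classical
  refine ⟨fun s hs hcov => ?_⟩
  have hcov' : ∀ x, ∃ n, x ∈ s n := iUnion_eq_univ_iff.1 hcov
  let N : X → ℕ := fun x => Nat.find (hcov' x)
  have hN : ∀ x, x ∈ s (N x) := fun x => Nat.find_spec (hcov' x)
  have hlsc : LowerSemicontinuous fun x => 1 / ((N x : ℝ) + 1) := fun x y hy => by
    filter_upwards [(hs _).mem_nhds (hN x)] with x' hx'
    exact hy.trans_le (Nat.one_div_le_one_div (Nat.find_min' _ hx'))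
  obtain ⟨f, hf, hfN⟩ := h _ hlsc fun x => Nat.one_div_pos_of_nat
  -- `t n` is cut out by `n < 1 / f`, where `N < 1 / f` and `1 / f` is locally bounded.
  let t : ℕ → Set X := fun n => s n ∩ {x | n * f x < 1}
  have hcover : ∀ x, x ∈ t (N x) := fun x => by
    have hle : f x * (N x + 1) ≤ 1 := (le_div_iff₀ (by positivity)).1 (hfN x).2
    exact ⟨hN x, by simp only [mem_ofPred_eq]; linarith [(hfN x).1]⟩
  have hfinite : LocallyFinite t := fun x => by
    obtain ⟨M, hM⟩ := exists_nat_gt (1 / f x)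
    have hMx : 1 < M * f x := (div_lt_iff₀ (hfN x).1).1 hM
    refine ⟨{y | 1 < M * f y}, (isOpen_lt (by fun_prop) (by fun_prop)).mem_nhds hMx,
      (finite_Iio M).subset ?_⟩
    rintro n ⟨y, ⟨-, hn⟩, hyM⟩
    exact_mod_cast lt_of_mul_lt_mul_right (hn.trans hyM) (hfN y).1.le
  have ht : ∀ n, IsOpen (t n) := fun n => (hs n).inter (isOpen_lt (by fun_prop) (by fun_prop))
  exact ⟨ULift.{u} ℕ, fun n => t n.down, fun n => ht n.down,
    iUnion_eq_univ_iff.2 fun x => ⟨⟨N x⟩, hcover x⟩,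
    hfinite.comp_injective ULift.down_injective, fun n => ⟨n.down, inter_subset_left⟩⟩

namespace HasNearbyIntervalSelections

variable {X : Type u} [TopologicalSpace X]

lemma exists_continuous_mem_Icc (h : HasNearbyIntervalSelections X) {a b : X → ℝ}
    (ha : UpperSemicontinuous a) (hb : LowerSemicontinuous b) (hab : ∀ x, a x ≤ b x) {ε : ℝ}
    (hε : 0 < ε) {g : X → ℝ} (hg : Continuous g)
    (hgab : IsApproxSelection (fun x => Icc (a x) (b x)) (fun _ => ε) g) :
    ∃ f : X → ℝ, Continuous f ∧ (∀ x, f x ∈ Icc (a x) (b x)) ∧ ∀ x, dist (f x) (g x) < ε :=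
  h _ ε g (fun x => nonempty_Icc.2 (hab x)) (fun _ => isCompact_Icc) (fun _ => convex_Icc _ _)
    (lowerHemicontinuous_Icc ha hb hab) hε hg hgab

theorem normalSpace (h : HasNearbyIntervalSelections X) : NormalSpace X := by
  refine ⟨fun A B hA hB hAB => ?_⟩
  have hle : ∀ x, B.indicator (fun _ => (1 : ℝ)) x ≤ Aᶜ.indicator (fun _ => 1) x :=
    indicator_le_indicator_of_subset hAB.subset_compl_left fun _ => zero_le_one
  obtain ⟨f, hf, hfI, -⟩ := h.exists_continuous_mem_Icc
    (hB.upperSemicontinuous_indicator zero_le_one)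
    (hA.isOpen_compl.lowerSemicontinuous_indicator zero_le_one) hle two_pos
    (continuous_const (y := (0 : ℝ))) fun x => by
      refine (infDist_le_dist_of_mem (left_mem_Icc.2 (hle x))).trans_lt ?_
      by_cases hx : x ∈ B <;> simp [hx]
  have hfA : ∀ x ∈ A, f x ≤ 0 := fun x hx => by simpa [hx] using (hfI x).2
  have hfB : ∀ x ∈ B, 1 ≤ f x := fun x hx => by simpa [hx] using (hfI x).1
  refine ⟨f ⁻¹' Iio (1 / 2), f ⁻¹' Ioi (1 / 2), isOpen_Iio.preimage hf, isOpen_Ioi.preimage hf,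
    fun x hx => (hfA x hx).trans_lt one_half_pos,
    fun x hx => one_half_lt_one.trans_le (hfB x hx), ?_⟩
  exact Disjoint.preimage f (by simp)

theorem exists_continuous_pos_le (h : HasNearbyIntervalSelections X) {k : X → ℝ}
    (hk : LowerSemicontinuous k) (hk0 : ∀ x, 0 < k x) :
    ∃ f : X → ℝ, Continuous f ∧ ∀ x, 0 < f x ∧ f x ≤ k x := by
  obtain ⟨f, hf, hfI, hf1⟩ := h.exists_continuous_mem_Icc upperSemicontinuous_const hk
    (fun x => (hk0 x).le) one_pos (continuous_const (y := (1 : ℝ))) fun x => by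
      have hmem : min (k x) 1 ∈ Icc 0 (k x) := ⟨le_min (hk0 x).le zero_le_one, min_le_left _ _⟩
      refine (infDist_le_dist_of_mem hmem).trans_lt ?_
      rw [Real.dist_eq, abs_of_nonneg (sub_nonneg.2 (min_le_right _ _))]
      exact sub_lt_self _ (lt_min (hk0 x) one_pos)
  refine ⟨f, hf, fun x => ⟨?_, (hfI x).2⟩⟩
  have hlt := (abs_lt.1 (Real.dist_eq (f x) 1 ▸ hf1 x)).1
  linarith

theorem countablyParacompactSpace (h : HasNearbyIntervalSelections X) :
    CountablyParacompactSpace X :=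
  countablyParacompactSpace_of_exists_continuous_pos_le fun _ => h.exists_continuous_pos_le

end HasNearbyIntervalSelections

theorem theorem4p1_general (X : Type u) [TopologicalSpace X] :
    List.TFAE [
      CountablyParacompactSpace X ∧ NormalSpace X,
      ∀ (E : Type v) [NormedAddCommGroup E] [NormedSpace ℝ E] [CompleteSpace E]
        [SeparableSpace E], HasNearbySelections X E,
      HasNearbyIntervalSelections X] := by
  tfae_have 1 → 2 := by
    rintro ⟨_, _⟩ E _ _ _ _
    exact hasNearbySelections_of_countablyParacompactSpace X E
  tfae_have 2 → 3 := by
    intro h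
    have : SeparableSpace (ULift.{v} ℝ) :=
      Homeomorph.ulift.symm.surjective.denseRange.separableSpace Homeomorph.ulift.symm.continuous
    exact ((h (ULift.{v} ℝ)).of_linearIsometryEquiv
      (LinearIsometryEquiv.ulift ℝ ℝ).symm).hasNearbyIntervalSelections
  tfae_have 3 → 1 := fun h => ⟨h.countablyParacompactSpace, h.normalSpace⟩
  tfae_finish

theorem theorem4p1 (X : Type u) [TopologicalSpace X] [T1Space X] :
    List.TFAE [
      CountablyParacompactSpace X ∧ NormalSpace X,
      ∀ (E : Type v) [NormedAddCommGroup E] [NormedSpace ℝ E] [CompleteSpace E]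
        [TopologicalSpace.SeparableSpace E]
        (φ : X → Set E) (η : X → ℝ) (g : X → E),
        (∀ x, (φ x).Nonempty) → (∀ x, IsClosed (φ x)) → (∀ x, Convex ℝ (φ x)) →
        LowerHemicontinuous φ →
        (∀ x, 0 < η x) → LowerSemicontinuous η →
        Continuous g → IsApproxSelection φ η g →
        ∃ f : X → E, Continuous f ∧ IsSelection φ f ∧ ∀ x, dist (f x) (g x) < η x,
      ∀ (φ : X → Set ℝ) (ε : ℝ) (g : X → ℝ),
        (∀ x, (φ x).Nonempty) → (∀ x, IsCompact (φ x)) → (∀ x, Convex ℝ (φ x)) →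
        LowerHemicontinuous φ →
        0 < ε →
        Continuous g → IsApproxSelection φ (fun _ => ε) g →
        ∃ f : X → ℝ, Continuous f ∧ IsSelection φ f ∧ ∀ x, dist (f x) (g x) < ε] :=
  theorem4p1_general X
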